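/- Let $\ell\ge 2$ and $t\ge 2$ be integers. There exists a constant $C=C(\ell,t)>0$, depending only on $\ell$ and $t$, such that the following holds for all $s$ and $n$. Let $K=2^{4\ell+2}$ and let $G$ be a (finite, simple) $n$-vertex graph which is $K$-almost-regular, i.e. $\Delta(G)\le K\,\delta(G)$, and contains no (not necessarily induced) subgraph isomorphic to the complete bipartite graph $K_{s,s}$. If $$e(G) > C\,(\ell t)^{20s}\, n^{1+\frac1\ell},$$ then at least a $1-\frac{1}{2t^2}$ fraction of the graph homomorphisms $\varphi\colon C_{2\ell}\to G$ (equivalently, of the closed walks with $2\ell$ edges in $G$, with a starting point and a direction) are induced $2\ell$-cycles, that is, the $2\ell$ vertices $\varphi(v_0),\dots,\varphi(v_{2\ell-1})$ are pairwise distinct and the only edges of $G$ among them are the $2\ell$ edges $\varphi(v_i)\varphi(v_{i+1})$ (indices modulo $2\ell$). -/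

import Mathlib

/-- `G` is `K`-almost-regular: `Δ(G) ≤ K δ(G)`. -/
def IsAlmostRegular {V : Type*} [Fintype V] (G : SimpleGraph V) [DecidableRel G.Adj]
    (K : ℝ) : Prop :=
  (G.maxDegree : ℝ) ≤ K * (G.minDegree : ℝ)

/-- `Hom(C_k, G)`: the homomorphic `k`-cycles, i.e. the closed `k`-walks
(with a base point and an orientation) of `G`. -/
abbrev HomCycle {V : Type*} (G : SimpleGraph V) (k : ℕ) : Type _ :=
  SimpleGraph.cycleGraph k →g G

/-- The homomorphic `k`-cycle `φ` is an induced `k`-cycle of `G`: its `k` vertices are pairwise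
distinct, and the only edges of `G` among them are those of the cycle. -/
def HomCycle.IsInduced {V : Type*} {G : SimpleGraph V} {k : ℕ} (φ : HomCycle G k) : Prop :=
  Function.Injective φ ∧
    ∀ i j : Fin k, G.Adj (φ i) (φ j) → (SimpleGraph.cycleGraph k).Adj i j

/-! Let A be the adjacency matrix and H_k = tr A^{2k}; there are at least H_l homomorphic 2l-cycles.
In a non-induced one, some two positions coincide or span a chord, so a union bound over at most
(2l)^2 pairs suffices.

Coincidences: cutting at the repeated vertex gives the count sum_v (A^m)_vv (A^{m'})_vv, which
log-convexity of n ↦ (A^{2n})_vv bounds by Δ H_{l-1} (`sum_diag_mul_le`). Log-convexity of H, with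
H_0 = n, almost-regularity and the edge density, makes this a small multiple of H_l
(`maxDegree_mul_closedWalks_le`).

Chords: fix antipodal cycle vertices a, b separating the chord's ends u, v. Then u and v vary
independently, each weighted by walks of length l from a to b. A weighted Kővári–Sós–Turán bound
(`edge_weight_le`) shows that only a fraction p of the pairs are edges, up to an error in the sums
of squared weights. Summed over a and b, these squares are again coincidence counts
(`sum_chord_le`). -/

/-! ### Log-convex sequences -/

theorem mul_le_mul_of_logConvex {b : ℕ → ℝ} (hpos : ∀ n, 0 < b n)
    (hb : ∀ n, b (n + 1) ^ 2 ≤ b n * b (n + 2)) (k i j : ℕ) :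
    b (k + i) * b (k + j) ≤ b k * b (k + i + j) := by
  have step : ∀ d m, b (m + 1) * b (m + d) ≤ b m * b (m + d + 1) := by
    intro d
    induction d with
    | zero => intro m; simp [mul_comm]
    | succ d ih =>
      intro m
      have h1 := ih (m + 1)
      have h2 := hb m
      have e : m + 1 + d = m + (d + 1) := by ring
      rw [e] at h1
      have p1 := hpos (m + 1)
      have p2 := hpos (m + 2)
      have : b (m + 1) * (b (m + 1) * b (m + (d + 1)))
          ≤ b (m + 1) * (b m * b (m + (d + 1) + 1)) := by
        calc b (m + 1) * (b (m + 1) * b (m + (d + 1)))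
            = b (m + 1) ^ 2 * b (m + (d + 1)) := by ring
          _ ≤ (b m * b (m + 2)) * b (m + (d + 1)) :=
              mul_le_mul_of_nonneg_right h2 (hpos _).le
          _ = b m * (b (m + 2) * b (m + (d + 1))) := by ring
          _ ≤ b m * (b (m + 1) * b (m + (d + 1) + 1)) :=
              mul_le_mul_of_nonneg_left h1 (hpos _).le
          _ = _ := by ring
      exact le_of_mul_le_mul_left this p1
  induction i with
  | zero => simp
  | succ i ih =>
    have h := step j (k + i)
    have : b (k + i) * (b (k + (i + 1)) * b (k + j))
        ≤ b (k + i) * (b k * b (k + (i + 1) + j)) := by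
      calc b (k + i) * (b (k + (i + 1)) * b (k + j))
          = (b (k + i) * b (k + j)) * b (k + i + 1) := by rw [← add_assoc]; ring
        _ ≤ (b k * b (k + i + j)) * b (k + i + 1) :=
            mul_le_mul_of_nonneg_right ih (hpos _).le
        _ = b k * (b (k + i + 1) * b (k + i + j)) := by ring
        _ ≤ b k * (b (k + i) * b (k + i + j + 1)) :=
            mul_le_mul_of_nonneg_left h (hpos _).le
        _ = _ := by
            rw [show k + (i + 1) + j = k + i + j + 1 by ring]; ring
    exact le_of_mul_le_mul_left this (hpos _)

/-- Convexity of log b, read at k between the endpoints 0 and k + 1. -/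
theorem pow_succ_le_of_logConvex {b : ℕ → ℝ} (hpos : ∀ n, 0 < b n)
    (hb : ∀ n, b (n + 1) ^ 2 ≤ b n * b (n + 2)) (k : ℕ) :
    b k ^ (k + 1) ≤ b 0 * b (k + 1) ^ k := by
  induction k with
  | zero => simp
  | succ k ih =>
    have h := pow_le_pow_left₀ (by positivity) (hb k) (k + 1)
    have p1 : 0 < b (k + 1) ^ k := pow_pos (hpos _) _
    have : b (k + 1) ^ k * b (k + 1) ^ (k + 1 + 1)
        ≤ b (k + 1) ^ k * (b 0 * b (k + 1 + 1) ^ (k + 1)) := by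
      calc b (k + 1) ^ k * b (k + 1) ^ (k + 1 + 1) = (b (k + 1) ^ 2) ^ (k + 1) := by ring
        _ ≤ (b k * b (k + 2)) ^ (k + 1) := h
        _ = b k ^ (k + 1) * b (k + 2) ^ (k + 1) := by ring
        _ ≤ (b 0 * b (k + 1) ^ k) * b (k + 2) ^ (k + 1) :=
            mul_le_mul_of_nonneg_right ih (pow_pos (hpos _) _).le
        _ = _ := by ring
    exact le_of_mul_le_mul_left this p1

/-! ### Closed walks and log-convexity -/

section Spectral

variable {V : Type*} [Fintype V] [DecidableEq V] (G : SimpleGraph V) [DecidableRel G.Adj]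

theorem adjMatrix_pow_symm (m : ℕ) (u v : V) :
    (G.adjMatrix ℝ ^ m) u v = (G.adjMatrix ℝ ^ m) v u := by
  have h : (G.adjMatrix ℝ ^ m).transpose = G.adjMatrix ℝ ^ m := by
    rw [Matrix.transpose_pow, SimpleGraph.transpose_adjMatrix]
  exact congrFun (congrFun h.symm u) v

theorem adjMatrix_pow_nonneg (m : ℕ) (u v : V) : 0 ≤ (G.adjMatrix ℝ ^ m) u v := by
  rw [SimpleGraph.adjMatrix_pow_apply_eq_card_walk]
  positivity

theorem adjMatrix_pow_add (i j : ℕ) (u v : V) :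
    (G.adjMatrix ℝ ^ (i + j)) u v
      = ∑ x, (G.adjMatrix ℝ ^ i) u x * (G.adjMatrix ℝ ^ j) x v := by
  rw [pow_add, Matrix.mul_apply]

/-- Cauchy–Schwarz over the vertex that splits a closed walk into lengths i and j. -/
theorem adjMatrix_pow_diag_sq_le (i j : ℕ) (v : V) :
    (G.adjMatrix ℝ ^ (i + j)) v v ^ 2
      ≤ (G.adjMatrix ℝ ^ (2 * i)) v v * (G.adjMatrix ℝ ^ (2 * j)) v v := by
  have h : ∀ i : ℕ, (G.adjMatrix ℝ ^ (2 * i)) v v = ∑ x, (G.adjMatrix ℝ ^ i) v x ^ 2 := by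
    intro i
    rw [two_mul, adjMatrix_pow_add]
    refine Finset.sum_congr rfl fun x _ => ?_
    rw [adjMatrix_pow_symm G i x v, sq]
  rw [h i, h j, adjMatrix_pow_add]
  simp_rw [adjMatrix_pow_symm G j _ v]
  exact Finset.sum_mul_sq_le_sq_mul_sq _ _ _

theorem adjMatrix_sq_diag (v : V) : (G.adjMatrix ℝ ^ (2 * 1)) v v = G.degree v := by
  rw [mul_one, sq, SimpleGraph.adjMatrix_mul_self_apply_self]

theorem adjMatrix_even_diag_logConvex (v : V) (n : ℕ) :
    (G.adjMatrix ℝ ^ (2 * (n + 1))) v v ^ 2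
      ≤ (G.adjMatrix ℝ ^ (2 * n)) v v * (G.adjMatrix ℝ ^ (2 * (n + 2))) v v := by
  have := adjMatrix_pow_diag_sq_le G n (n + 2) v
  rwa [show n + (n + 2) = 2 * (n + 1) by ring] at this

theorem adjMatrix_even_diag_pos {v : V} (hv : 0 < G.degree v) (n : ℕ) :
    0 < (G.adjMatrix ℝ ^ (2 * n)) v v := by
  have key : ∀ n, 0 < (G.adjMatrix ℝ ^ (2 * n)) v v ∧
      0 < (G.adjMatrix ℝ ^ (2 * (n + 1))) v v := by
    intro n
    induction n with
    | zero =>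
      refine ⟨by simp, ?_⟩
      rw [zero_add, adjMatrix_sq_diag]
      exact_mod_cast hv
    | succ n ih =>
      refine ⟨ih.2, ?_⟩
      have h := adjMatrix_even_diag_logConvex G v n
      have : 0 < (G.adjMatrix ℝ ^ (2 * n)) v v * (G.adjMatrix ℝ ^ (2 * (n + 2))) v v :=
        lt_of_lt_of_le (pow_pos ih.2 2) h
      exact pos_of_mul_pos_right this ih.1.le
  exact (key n).1

/-- Log-convexity pushes the pair (i, j) out to (1, k), and (A^2)_vv is the degree of v. -/
theorem adjMatrix_even_diag_mul_le {v : V} (hv : 0 < G.degree v) {i j k : ℕ}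
    (hi : 1 ≤ i) (hj : 1 ≤ j) (hk : i + j = k + 1) :
    (G.adjMatrix ℝ ^ (2 * i)) v v * (G.adjMatrix ℝ ^ (2 * j)) v v
      ≤ G.maxDegree * (G.adjMatrix ℝ ^ (2 * k)) v v := by
  obtain ⟨i, rfl⟩ := Nat.exists_eq_add_of_le hi
  obtain ⟨j, rfl⟩ := Nat.exists_eq_add_of_le hj
  obtain rfl : k = 1 + i + j := by omega
  have h := mul_le_mul_of_logConvex (b := fun n => (G.adjMatrix ℝ ^ (2 * n)) v v)
    (adjMatrix_even_diag_pos G hv) (adjMatrix_even_diag_logConvex G v) 1 i j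
  refine h.trans (mul_le_mul_of_nonneg_right ?_ (adjMatrix_pow_nonneg G _ _ _))
  rw [adjMatrix_sq_diag]
  exact_mod_cast G.degree_le_maxDegree v

theorem adjMatrix_diag_mul_le {v : V} (hv : 0 < G.degree v) {m m' k : ℕ}
    (hm : 1 ≤ m) (hm' : 1 ≤ m') (hk : m + m' = 2 * (k + 1)) :
    (G.adjMatrix ℝ ^ m) v v * (G.adjMatrix ℝ ^ m') v v
      ≤ G.maxDegree * (G.adjMatrix ℝ ^ (2 * k)) v v := by
  have hR : 0 ≤ (G.maxDegree : ℝ) * (G.adjMatrix ℝ ^ (2 * k)) v v :=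
    mul_nonneg (by positivity) (adjMatrix_pow_nonneg G _ _ _)
  rcases Nat.even_or_odd' m with ⟨i, rfl | rfl⟩
  · obtain ⟨j, rfl⟩ : ∃ j, m' = 2 * j := ⟨k + 1 - i, by omega⟩
    exact adjMatrix_even_diag_mul_le G hv (by omega) (by omega) (by omega)
  · obtain ⟨j, rfl⟩ : ∃ j, m' = 2 * j + 1 := ⟨k - i, by omega⟩
    -- An exponent equal to 1 gives 0, since G has no loops.
    rcases Nat.eq_zero_or_pos i with rfl | hi
    · simpa using hR
    rcases Nat.eq_zero_or_pos j with rfl | hj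
    · simpa using hR
    have h1 := adjMatrix_pow_diag_sq_le G i (i + 1) v
    have h2 := adjMatrix_pow_diag_sq_le G j (j + 1) v
    rw [show i + (i + 1) = 2 * i + 1 by ring] at h1
    rw [show j + (j + 1) = 2 * j + 1 by ring] at h2
    have h3 := adjMatrix_even_diag_mul_le G hv (i := i) (j := j + 1) (k := k)
      (by omega) (by omega) (by omega)
    have h4 := adjMatrix_even_diag_mul_le G hv (i := i + 1) (j := j) (k := k)
      (by omega) (by omega) (by omega)
    -- For odd exponents, squares are compared: Cauchy–Schwarz yields the half-exponents i, i+1, j,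
    -- j+1, regrouped as (i, j+1) and (i+1, j), each of sum k + 1.
    refine abs_le_of_sq_le_sq' ?_ hR |>.2
    have n1 := fun m => adjMatrix_pow_nonneg G m v v
    calc _ = (G.adjMatrix ℝ ^ (2 * i + 1)) v v ^ 2 * (G.adjMatrix ℝ ^ (2 * j + 1)) v v ^ 2 := by
          ring
      _ ≤ _ := mul_le_mul h1 h2 (sq_nonneg _) (mul_nonneg (n1 _) (n1 _))
      _ = ((G.adjMatrix ℝ ^ (2 * i)) v v * (G.adjMatrix ℝ ^ (2 * (j + 1))) v v) *
          ((G.adjMatrix ℝ ^ (2 * (i + 1))) v v * (G.adjMatrix ℝ ^ (2 * j)) v v) := by ring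
      _ ≤ _ := mul_le_mul h3 h4 (mul_nonneg (n1 _) (n1 _)) hR
      _ = _ := by ring

/-- The number of closed walks of length `2k`. -/
noncomputable def closedWalks (k : ℕ) : ℝ := ∑ v, (G.adjMatrix ℝ ^ (2 * k)) v v

theorem closedWalks_eq_sum_sq (k : ℕ) :
    closedWalks G k = ∑ a, ∑ b, (G.adjMatrix ℝ ^ k) a b ^ 2 := by
  unfold closedWalks
  refine Finset.sum_congr rfl fun a _ => ?_
  rw [two_mul, adjMatrix_pow_add]
  refine Finset.sum_congr rfl fun x _ => ?_
  rw [adjMatrix_pow_symm G k x a, sq]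

theorem sum_diag_mul_le (hdeg : 0 < G.minDegree) {m m' k : ℕ}
    (hm : 1 ≤ m) (hm' : 1 ≤ m') (hk : m + m' = 2 * (k + 1)) :
    ∑ v, (G.adjMatrix ℝ ^ m) v v * (G.adjMatrix ℝ ^ m') v v
      ≤ G.maxDegree * closedWalks G k := by
  rw [closedWalks, Finset.mul_sum]
  exact Finset.sum_le_sum fun v _ =>
    adjMatrix_diag_mul_le G (hdeg.trans_le (G.minDegree_le_degree v)) hm hm' hk

theorem closedWalks_pos [Nonempty V] (hdeg : 0 < G.minDegree) (k : ℕ) : 0 < closedWalks G k :=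
  Finset.sum_pos (fun v _ => adjMatrix_even_diag_pos G
    (hdeg.trans_le (G.minDegree_le_degree v)) k) Finset.univ_nonempty

theorem closedWalks_logConvex (n : ℕ) :
    closedWalks G (n + 1) ^ 2 ≤ closedWalks G n * closedWalks G (n + 2) :=
  Finset.sum_sq_le_sum_mul_sum_of_sq_le_mul _ (fun _ _ => adjMatrix_pow_nonneg G _ _ _)
    (fun _ _ => adjMatrix_pow_nonneg G _ _ _) (fun v _ => adjMatrix_even_diag_logConvex G v n)

theorem minDegree_pow_le_sum (k : ℕ) (a : V) :
    (G.minDegree : ℝ) ^ k ≤ ∑ b, (G.adjMatrix ℝ ^ k) a b := by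
  induction k with
  | zero => simp [Matrix.one_apply]
  | succ k ih =>
    have hrow : ∀ x, ∑ b, G.adjMatrix ℝ x b = G.degree x := by
      intro x
      simp [SimpleGraph.adjMatrix_apply, ← SimpleGraph.card_neighborFinset_eq_degree,
        SimpleGraph.neighborFinset_eq_filter]
    simp_rw [adjMatrix_pow_add G k 1 a, pow_one]
    rw [Finset.sum_comm]
    simp_rw [← Finset.mul_sum, hrow]
    rw [pow_succ]
    calc _ ≤ (∑ b, (G.adjMatrix ℝ ^ k) a b) * (G.minDegree : ℝ) :=
          mul_le_mul_of_nonneg_right ih (by positivity)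
      _ ≤ _ := by
        rw [Finset.sum_mul]
        refine Finset.sum_le_sum fun x _ =>
          mul_le_mul_of_nonneg_left ?_ (adjMatrix_pow_nonneg G _ _ _)
        exact_mod_cast G.minDegree_le_degree x

/-- Cauchy–Schwarz over the n^2 pairs of endpoints: at least n δ^k walks of length k are spread over
them. -/
theorem minDegree_pow_le_closedWalks [Nonempty V] (k : ℕ) :
    (G.minDegree : ℝ) ^ (2 * k) ≤ closedWalks G k := by
  have h1 : (Fintype.card V : ℝ) * (G.minDegree : ℝ) ^ k
      ≤ ∑ z : V × V, (G.adjMatrix ℝ ^ k) z.1 z.2 := by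
    rw [Fintype.sum_prod_type]
    calc _ = ∑ _a : V, (G.minDegree : ℝ) ^ k := by simp
      _ ≤ _ := Finset.sum_le_sum fun a _ => minDegree_pow_le_sum G k a
  have h2 := sq_sum_le_card_mul_sum_sq (s := (Finset.univ : Finset (V × V)))
    (f := fun z => (G.adjMatrix ℝ ^ k) z.1 z.2)
  rw [Fintype.sum_prod_type (f := fun z : V × V => (G.adjMatrix ℝ ^ k) z.1 z.2 ^ 2),
    ← closedWalks_eq_sum_sq, Finset.card_univ, Fintype.card_prod] at h2
  push_cast at h2
  have hn : 0 < (Fintype.card V : ℝ) := by exact_mod_cast Fintype.card_pos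
  have h3 := pow_le_pow_left₀ (by positivity) h1 2
  refine le_of_mul_le_mul_left ?_ (mul_pos hn hn)
  calc _ = ((Fintype.card V : ℝ) * (G.minDegree : ℝ) ^ k) ^ 2 := by ring
    _ ≤ _ := h3.trans h2

/-- After raising to the power k + 1, H_k is interpolated between H_0 = n and H_{k+1}. The factor n
is absorbed by `hmax`, and the resulting Δ^{2(k+1)} is at most K^{2(k+1)} δ^{2(k+1)}, where
δ^{2(k+1)} ≤ H_{k+1}. -/
theorem maxDegree_mul_closedWalks_le [Nonempty V] {K D : ℝ} {k : ℕ} (hK : 0 < K) (hD : 0 < D)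
    (hdeg : 0 < G.minDegree) (hreg : (G.maxDegree : ℝ) ≤ K * G.minDegree)
    (hmax : D ^ (k + 1) * Fintype.card V ≤ (G.maxDegree : ℝ) ^ (k + 1)) :
    G.maxDegree * closedWalks G k ≤ K ^ 2 / D * closedWalks G (k + 1) := by
  set H := closedWalks G
  set Δ : ℝ := (G.maxDegree : ℝ)
  set δ : ℝ := (G.minDegree : ℝ)
  have hH : ∀ n, 0 < H n := closedWalks_pos G hdeg
  have hδ : 0 < δ := by simpa [δ] using hdeg
  have hΔ : 0 < Δ := by
    have : δ ≤ Δ := by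
      simp only [δ, Δ]; exact_mod_cast G.minDegree_le_maxDegree
    linarith
  have h0 : H 0 = Fintype.card V := by simp [H, closedWalks]
  have h1 : H k ^ (k + 1) ≤ H 0 * H (k + 1) ^ k :=
    pow_succ_le_of_logConvex hH (closedWalks_logConvex G) k
  have h2 : δ ^ (2 * (k + 1)) ≤ H (k + 1) := minDegree_pow_le_closedWalks G (k + 1)
  refine le_of_pow_le_pow_left₀ (Nat.succ_ne_zero k)
    (mul_nonneg (by positivity) (hH _).le) ?_
  have hpos : 0 < D ^ (k + 1) * δ ^ (2 * (k + 1)) := by positivity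
  refine le_of_mul_le_mul_left ?_ hpos
  have hreg' : Δ ^ (2 * (k + 1)) ≤ K ^ (2 * (k + 1)) * δ ^ (2 * (k + 1)) := by
    rw [← mul_pow]; exact pow_le_pow_left₀ hΔ.le hreg _
  have p1 : 0 < H k ^ (k + 1) := pow_pos (hH _) _
  have p2 : 0 < H (k + 1) ^ k := pow_pos (hH _) _
  have p3 := hH (k + 1)
  calc D ^ (k + 1) * δ ^ (2 * (k + 1)) * (Δ * H k) ^ (k + 1)
      = D ^ (k + 1) * δ ^ (2 * (k + 1)) * Δ ^ (k + 1) * H k ^ (k + 1) := by ring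
    _ ≤ D ^ (k + 1) * δ ^ (2 * (k + 1)) * Δ ^ (k + 1) * (H 0 * H (k + 1) ^ k) := by gcongr
    _ = (D ^ (k + 1) * H 0) * Δ ^ (k + 1) * δ ^ (2 * (k + 1)) * H (k + 1) ^ k := by ring
    _ ≤ Δ ^ (k + 1) * Δ ^ (k + 1) * H (k + 1) * H (k + 1) ^ k := by
        rw [h0]; gcongr
    _ = Δ ^ (2 * (k + 1)) * H (k + 1) ^ (k + 1) := by ring
    _ ≤ K ^ (2 * (k + 1)) * δ ^ (2 * (k + 1)) * H (k + 1) ^ (k + 1) := by gcongr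
    _ = D ^ (k + 1) * δ ^ (2 * (k + 1)) * (K ^ 2 / D * H (k + 1)) ^ (k + 1) := by
        rw [mul_pow, div_pow, ← pow_mul]; field_simp

end Spectral

/-! ### A weighted Kővári–Sós–Turán inequality -/

section WeightedKST

theorem card_common_neighbors_le {V : Type*} [Fintype V] (G : SimpleGraph V) [DecidableRel G.Adj] {s : ℕ}
    (hfree : (completeBipartiteGraph (Fin s) (Fin s)).Free G) {u : Fin s → V}
    (hu : Function.Injective u) :
    (Finset.univ.filter fun v => ∀ k, G.Adj (u k) v).card ≤ s := by
  by_contra! hcard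
  set T := Finset.univ.filter fun v => ∀ k, G.Adj (u k) v
  obtain ⟨g⟩ : Nonempty (Fin s ↪ T) :=
    Function.Embedding.nonempty_of_card_le (by simpa using hcard.le)
  have hg : ∀ k j, G.Adj (u k) (g j) := fun k j => (Finset.mem_filter.1 (g j).2).2 k
  refine hfree ⟨⟨⟨Sum.elim u fun j => (g j : V), ?_⟩, ?_⟩⟩
  · rintro (a | a) (b | b) h <;> simp at h
    · simpa using hg a b
    · simpa using (hg b a).symm
  · rintro (a | a) (b | b) h
    · exact congrArg _ (hu h)
    · exact absurd h (hg a b).ne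
    · exact absurd h (hg b a).ne'
    · exact congrArg _ (g.injective (Subtype.ext h))

variable {V : Type*} [Fintype V] [DecidableEq V]

/-- The collision probability of two independent samples. With the common value x fixed, the sum
factors over coordinates: i and j give μ x, the others 1. -/
theorem sum_prod_of_apply_eq (s : ℕ) (μ : V → ℝ) (h1 : ∑ v, μ v = 1) {i j : Fin s} (hij : i ≠ j) :
    ∑ u : Fin s → V with u i = u j, ∏ k, μ (u k) = ∑ v, μ v ^ 2 := by
  have key : ∀ x : V, ∑ u : Fin s → V, (if u i = x ∧ u j = x then ∏ k, μ (u k) else 0)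
      = μ x ^ 2 := by
    intro x
    let f : Fin s → V → ℝ := fun k y => if k = i ∨ k = j then (if y = x then μ y else 0) else μ y
    have hf : ∀ u : Fin s → V,
        (if u i = x ∧ u j = x then ∏ k, μ (u k) else 0) = ∏ k, f k (u k) := by
      intro u
      split_ifs with h
      · refine Finset.prod_congr rfl fun k _ => ?_
        simp only [f]
        split_ifs with h1 h2
        · rfl
        · rcases h1 with rfl | rfl
          · exact absurd h.1 h2
          · exact absurd h.2 h2
        · rfl
      · rw [not_and_or] at h
        rcases h with h | h
        · exact (Finset.prod_eq_zero (Finset.mem_univ i) (by simp [f, h])).symm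
        · exact (Finset.prod_eq_zero (Finset.mem_univ j) (by simp [f, h])).symm
    simp_rw [hf]
    have := Finset.prod_univ_sum (fun _ : Fin s => (Finset.univ : Finset V)) f
    rw [Fintype.piFinset_univ] at this
    rw [← this]
    have hsum : ∀ k, ∑ y, f k y = if k ∈ ({i, j} : Finset (Fin s)) then μ x else 1 := by
      intro k
      simp only [f, Finset.mem_insert, Finset.mem_singleton]
      split_ifs with h
      · simp
      · exact h1
    simp_rw [hsum]
    rw [Finset.prod_ite_mem]
    simp [Finset.card_pair hij]
  rw [Finset.sum_filter]
  simp_rw [← key]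
  rw [Finset.sum_comm]
  refine Finset.sum_congr rfl fun u _ => ?_
  by_cases h : u i = u j
  · simp [h]
  · rw [if_neg h]
    refine (Finset.sum_eq_zero fun x _ => if_neg ?_).symm
    rintro ⟨h1, h2⟩
    exact h (h1.trans h2.symm)

/-- A weighted Kővári–Sós–Turán inequality. -/
theorem pow_edge_weight_le (G : SimpleGraph V) [DecidableRel G.Adj] {s : ℕ}
    (hfree : (completeBipartiteGraph (Fin s) (Fin s)).Free G) (μ ν : V → ℝ)
    (hμ : ∀ v, 0 ≤ μ v) (hν : ∀ v, 0 ≤ ν v) (hμ1 : ∑ v, μ v = 1) (hν1 : ∑ v, ν v = 1) :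
    (∑ u, ∑ v, μ u * ν v * G.adjMatrix ℝ u v) ^ s
      ≤ (s : ℝ) ^ 2 * ∑ v, μ v ^ 2 + s * √(∑ v, ν v ^ 2) := by
  have hA : ∀ u v, 0 ≤ G.adjMatrix ℝ u v := fun u v => by
    rw [SimpleGraph.adjMatrix_apply]; split_ifs <;> norm_num
  have hνle : ∀ v, ν v ≤ √(∑ v, ν v ^ 2) := fun v =>
    Real.le_sqrt_of_sq_le (Finset.single_le_sum (f := fun v => ν v ^ 2)
      (fun _ _ => sq_nonneg _) (Finset.mem_univ v))
  have hprod : ∀ u : Fin s → V, 0 ≤ ∏ k, μ (u k) := fun u => Finset.prod_nonneg fun _ _ => hμ _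
  have hsum1 : ∑ u : Fin s → V, ∏ k, μ (u k) = 1 := by
    have := Finset.prod_univ_sum (fun _ : Fin s => (Finset.univ : Finset V)) (fun _ => μ)
    rw [Fintype.piFinset_univ] at this
    rw [← this]; simp [hμ1]
  -- `c u` is the ν-mass of the common neighbourhood of s vertices sampled from μ. It is small for
  -- distinct samples; otherwise it is at most 1 and is charged to a colliding pair.
  set c : (Fin s → V) → ℝ := fun u => ∑ v, ν v * ∏ k, G.adjMatrix ℝ (u k) v with hc
  have hprodA : ∀ (u : Fin s → V) v,
      ∏ k, G.adjMatrix ℝ (u k) v = if ∀ k, G.Adj (u k) v then 1 else 0 := by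
    intro u v
    simp only [SimpleGraph.adjMatrix_apply]
    rw [Finset.prod_ite_zero]
    simp
  have hc_eq : ∀ u, c u = ∑ v with ∀ k, G.Adj (u k) v, ν v := by
    intro u
    simp only [hc, hprodA, mul_ite, mul_one, mul_zero]
    rw [Finset.sum_filter]
  have hc1 : ∀ u, c u ≤ 1 := by
    intro u
    rw [hc_eq, ← hν1]
    exact Finset.sum_le_sum_of_subset_of_nonneg (Finset.filter_subset _ _) fun v _ _ => hν v
  have hc2 : ∀ u, Function.Injective u → c u ≤ s * √(∑ v, ν v ^ 2) := by
    intro u hu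
    rw [hc_eq]
    refine (Finset.sum_le_card_nsmul _ _ _ fun v _ => hνle v).trans ?_
    rw [nsmul_eq_mul]
    refine mul_le_mul_of_nonneg_right ?_ (Real.sqrt_nonneg _)
    exact_mod_cast card_common_neighbors_le G hfree hu
  have jensen : (∑ u, ∑ v, μ u * ν v * G.adjMatrix ℝ u v) ^ s
      ≤ ∑ v, ν v * (∑ u, μ u * G.adjMatrix ℝ u v) ^ s := by
    have e : ∑ u, ∑ v, μ u * ν v * G.adjMatrix ℝ u v
        = ∑ v, ν v * ∑ u, μ u * G.adjMatrix ℝ u v := by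
      rw [Finset.sum_comm]
      refine Finset.sum_congr rfl fun v _ => ?_
      rw [Finset.mul_sum]
      exact Finset.sum_congr rfl fun u _ => by ring
    rw [e]
    exact Real.pow_arith_mean_le_arith_mean_pow _ _ _ (fun v _ => hν v) hν1
      (fun v _ => Finset.sum_nonneg fun u _ => mul_nonneg (hμ u) (hA u v)) s
  have expand : ∑ v, ν v * (∑ u, μ u * G.adjMatrix ℝ u v) ^ s
      = ∑ u : Fin s → V, (∏ k, μ (u k)) * c u := by
    have e : ∀ v, (∑ u, μ u * G.adjMatrix ℝ u v) ^ s
        = ∑ u : Fin s → V, ∏ k, (μ (u k) * G.adjMatrix ℝ (u k) v) := by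
      intro v
      have := Finset.prod_univ_sum (fun _ : Fin s => (Finset.univ : Finset V))
        (fun _ u => μ u * G.adjMatrix ℝ u v)
      rw [Fintype.piFinset_univ] at this
      rw [← this]; simp
    simp_rw [e, hc, Finset.mul_sum]
    rw [Finset.sum_comm]
    refine Finset.sum_congr rfl fun u _ => Finset.sum_congr rfl fun v _ => ?_
    rw [Finset.prod_mul_distrib]; ring
  have pointwise : ∀ u : Fin s → V, (∏ k, μ (u k)) * c u
      ≤ (∑ z : Fin s × Fin s with z.1 ≠ z.2, if u z.1 = u z.2 then ∏ k, μ (u k) else 0)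
        + (∏ k, μ (u k)) * (s * √(∑ v, ν v ^ 2)) := by
    intro u
    have n1 : 0 ≤ ∑ z : Fin s × Fin s with z.1 ≠ z.2,
        if u z.1 = u z.2 then ∏ k, μ (u k) else 0 :=
      Finset.sum_nonneg fun z _ => by split_ifs <;> [exact hprod u; exact le_rfl]
    by_cases hu : Function.Injective u
    · have := mul_le_mul_of_nonneg_left (hc2 u hu) (hprod u)
      linarith
    · rw [Function.not_injective_iff] at hu
      obtain ⟨i, j, hij, hne⟩ := hu
      have h2 : ∏ k, μ (u k) ≤ ∑ z : Fin s × Fin s with z.1 ≠ z.2,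
          if u z.1 = u z.2 then ∏ k, μ (u k) else 0 := by
        have := Finset.single_le_sum
          (f := fun z : Fin s × Fin s => if u z.1 = u z.2 then ∏ k, μ (u k) else 0)
          (s := Finset.univ.filter fun z => z.1 ≠ z.2) (a := (i, j))
          (fun z _ => by split_ifs <;> [exact hprod u; exact le_rfl]) (by simp [hne])
        simpa [hij] using this
      have h3 := mul_le_mul_of_nonneg_left (hc1 u) (hprod u)
      have h4 : 0 ≤ (∏ k, μ (u k)) * (s * √(∑ v, ν v ^ 2)) :=
        mul_nonneg (hprod u) (by positivity)
      linarith
  have coll : ∑ u : Fin s → V, ∑ z : Fin s × Fin s with z.1 ≠ z.2,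
      (if u z.1 = u z.2 then ∏ k, μ (u k) else 0) ≤ (s : ℝ) ^ 2 * ∑ v, μ v ^ 2 := by
    rw [Finset.sum_comm]
    have : ∀ z ∈ (Finset.univ.filter fun z : Fin s × Fin s => z.1 ≠ z.2),
        ∑ u : Fin s → V, (if u z.1 = u z.2 then ∏ k, μ (u k) else 0) = ∑ v, μ v ^ 2 := by
      intro z hz
      rw [← Finset.sum_filter]
      exact sum_prod_of_apply_eq s μ hμ1 (Finset.mem_filter.1 hz).2
    rw [Finset.sum_congr rfl this, Finset.sum_const, nsmul_eq_mul]
    refine mul_le_mul_of_nonneg_right ?_ (Finset.sum_nonneg fun _ _ => sq_nonneg _)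
    have := Finset.card_filter_le (Finset.univ : Finset (Fin s × Fin s)) (fun z => z.1 ≠ z.2)
    simp only [Finset.card_univ, Fintype.card_prod, Fintype.card_fin] at this
    rw [sq]; exact_mod_cast this
  calc _ ≤ _ := jensen
    _ = _ := expand
    _ ≤ _ := Finset.sum_le_sum fun u _ => pointwise u
    _ ≤ _ := by
      rw [Finset.sum_add_distrib, ← Finset.sum_mul, hsum1, one_mul]
      exact add_le_add_left coll _

/-- If this failed, q ≤ 1 would force N(α + β) < 1 and q ≥ p. The choice of N then gives s²α ≤ p^s/4
and s√β ≤ p^s/2, so q^s ≤ (3/4) p^s, a contradiction. -/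
theorem edge_weight_le_of_sum_one (G : SimpleGraph V) [DecidableRel G.Adj] {s : ℕ}
    (hfree : (completeBipartiteGraph (Fin s) (Fin s)).Free G) {p N : ℝ} (hp : 0 < p) (hp1 : p ≤ 1)
    (hN : 4 * (s : ℝ) ^ 2 ≤ N * p ^ (2 * s)) (hN0 : 0 ≤ N) (μ ν : V → ℝ)
    (hμ : ∀ v, 0 ≤ μ v) (hν : ∀ v, 0 ≤ ν v) (hμ1 : ∑ v, μ v = 1) (hν1 : ∑ v, ν v = 1) :
    ∑ u, ∑ v, μ u * ν v * G.adjMatrix ℝ u v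
      ≤ p + N * (∑ v, μ v ^ 2 + ∑ v, ν v ^ 2) := by
  have hkst := pow_edge_weight_le G hfree μ ν hμ hν hμ1 hν1
  set q := ∑ u, ∑ v, μ u * ν v * G.adjMatrix ℝ u v
  set α := ∑ v, μ v ^ 2
  set β := ∑ v, ν v ^ 2
  have hα : 0 ≤ α := Finset.sum_nonneg fun _ _ => sq_nonneg _
  have hβ : 0 ≤ β := Finset.sum_nonneg fun _ _ => sq_nonneg _
  have hq1 : q ≤ 1 := by
    have : q ≤ ∑ u, ∑ v, μ u * ν v := by
      refine Finset.sum_le_sum fun u _ => Finset.sum_le_sum fun v _ => ?_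
      refine mul_le_of_le_one_right (mul_nonneg (hμ u) (hν v)) ?_
      rw [SimpleGraph.adjMatrix_apply]; split_ifs <;> norm_num
    rwa [← Finset.sum_mul_sum, hμ1, hν1, one_mul] at this
  by_contra! hlt
  have hNαβ : N * α + N * β < 1 := by nlinarith
  have hpq : p ≤ q := by nlinarith [mul_nonneg hN0 (add_nonneg hα hβ)]
  have hps : p ^ s ≤ q ^ s := pow_le_pow_left₀ hp.le hpq s
  have hpp : 0 < p ^ s := pow_pos hp s
  have hpp1 : p ^ s ≤ 1 := pow_le_one₀ hp.le hp1
  rw [mul_comm 2 s, pow_mul] at hN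
  have hNα : 0 ≤ N * α := mul_nonneg hN0 hα
  have hNβ : 0 ≤ N * β := mul_nonneg hN0 hβ
  have h1 : 4 * ((s : ℝ) ^ 2 * α) ≤ (p ^ s) ^ 2 := by
    calc 4 * ((s : ℝ) ^ 2 * α) = 4 * (s : ℝ) ^ 2 * α := by ring
      _ ≤ N * (p ^ s) ^ 2 * α := mul_le_mul_of_nonneg_right hN hα
      _ = (p ^ s) ^ 2 * (N * α) := by ring
      _ ≤ (p ^ s) ^ 2 * 1 := mul_le_mul_of_nonneg_left (by linarith) (sq_nonneg _)
      _ = _ := mul_one _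
  have h2 : (2 * (s * √β)) ^ 2 ≤ (p ^ s) ^ 2 := by
    calc (2 * (s * √β)) ^ 2 = 4 * (s : ℝ) ^ 2 * β := by
          rw [mul_pow, mul_pow, Real.sq_sqrt hβ]; ring
      _ ≤ N * (p ^ s) ^ 2 * β := mul_le_mul_of_nonneg_right hN hβ
      _ = (p ^ s) ^ 2 * (N * β) := by ring
      _ ≤ (p ^ s) ^ 2 * 1 := mul_le_mul_of_nonneg_left (by linarith) (sq_nonneg _)
      _ = _ := mul_one _
  have h3 := (abs_le_of_sq_le_sq' h2 hpp.le).2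
  have h4 : (p ^ s) ^ 2 ≤ p ^ s := by nlinarith
  linarith

theorem edge_weight_le (G : SimpleGraph V) [DecidableRel G.Adj] {s : ℕ}
    (hfree : (completeBipartiteGraph (Fin s) (Fin s)).Free G) {p N : ℝ} (hp : 0 < p) (hp1 : p ≤ 1)
    (hN : 4 * (s : ℝ) ^ 2 ≤ N * p ^ (2 * s)) (hN0 : 0 ≤ N) (μ ν : V → ℝ) {w : ℝ}
    (hμ : ∀ v, 0 ≤ μ v) (hν : ∀ v, 0 ≤ ν v) (hμw : ∑ v, μ v = w) (hνw : ∑ v, ν v = w) :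
    ∑ u, ∑ v, μ u * ν v * G.adjMatrix ℝ u v
      ≤ p * w ^ 2 + N * (∑ v, μ v ^ 2 + ∑ v, ν v ^ 2) := by
  have hw0 : 0 ≤ w := hμw ▸ Finset.sum_nonneg fun v _ => hμ v
  rcases hw0.eq_or_lt with rfl | hw
  · have : ∀ v, μ v = 0 := by
      simpa using (Finset.sum_eq_zero_iff_of_nonneg fun v _ => hμ v).1 hμw
    simp only [this, zero_mul, Finset.sum_const_zero]
    positivity
  · have h := edge_weight_le_of_sum_one G hfree hp hp1 hN hN0 (fun v => μ v / w) (fun v => ν v / w)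
      (fun v => div_nonneg (hμ v) hw0) (fun v => div_nonneg (hν v) hw0)
      (by rw [← Finset.sum_div, hμw, div_self hw.ne'])
      (by rw [← Finset.sum_div, hνw, div_self hw.ne'])
    have e : ∑ u, ∑ v, μ u / w * (ν v / w) * G.adjMatrix ℝ u v
        = (∑ u, ∑ v, μ u * ν v * G.adjMatrix ℝ u v) / w ^ 2 := by
      simp_rw [Finset.sum_div]
      refine Finset.sum_congr rfl fun u _ => Finset.sum_congr rfl fun v _ => ?_
      ring
    simp_rw [e, div_pow, ← Finset.sum_div] at h
    rw [div_le_iff₀ (by positivity)] at h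
    refine h.trans (le_of_eq ?_)
    field_simp

end WeightedKST

/-! ### Counting closed walks with a chord -/

section Chords

variable {V : Type*} [Fintype V] [DecidableEq V] (G : SimpleGraph V) [DecidableRel G.Adj]

/-- Squaring doubles each half-walk into a closed walk at u, so the error terms of `edge_weight_le`
become coincidence counts. -/
theorem sum_sq_midpoint (i j : ℕ) :
    ∑ a, ∑ b, ∑ u, ((G.adjMatrix ℝ ^ i) a u * (G.adjMatrix ℝ ^ j) u b) ^ 2
      = ∑ u, (G.adjMatrix ℝ ^ (2 * i)) u u * (G.adjMatrix ℝ ^ (2 * j)) u u := by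
  have e : ∀ u, (G.adjMatrix ℝ ^ (2 * i)) u u * (G.adjMatrix ℝ ^ (2 * j)) u u
      = ∑ a, ∑ b, ((G.adjMatrix ℝ ^ i) a u * (G.adjMatrix ℝ ^ j) u b) ^ 2 := by
    intro u
    rw [two_mul, two_mul, adjMatrix_pow_add, adjMatrix_pow_add, Finset.sum_mul_sum]
    refine Finset.sum_congr rfl fun a _ => Finset.sum_congr rfl fun b _ => ?_
    rw [adjMatrix_pow_symm G i u a, adjMatrix_pow_symm G j b u]; ring
  simp_rw [e]
  symm
  rw [Finset.sum_comm]
  exact Finset.sum_congr rfl fun a _ => Finset.sum_comm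

theorem sum_chord_eq (i j i' j' : ℕ) :
    ∑ u, ∑ v, G.adjMatrix ℝ u v * ((G.adjMatrix ℝ ^ (i + j)) u v * (G.adjMatrix ℝ ^ (i' + j')) v u)
      = ∑ a, ∑ b, ∑ u, ∑ v, ((G.adjMatrix ℝ ^ i) a u * (G.adjMatrix ℝ ^ i') u b) *
          ((G.adjMatrix ℝ ^ j) a v * (G.adjMatrix ℝ ^ j') v b) * G.adjMatrix ℝ u v := by
  have e : ∀ u v, G.adjMatrix ℝ u v *
      ((G.adjMatrix ℝ ^ (i + j)) u v * (G.adjMatrix ℝ ^ (i' + j')) v u)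
      = ∑ a, ∑ b, ((G.adjMatrix ℝ ^ i) a u * (G.adjMatrix ℝ ^ i') u b) *
          ((G.adjMatrix ℝ ^ j) a v * (G.adjMatrix ℝ ^ j') v b) * G.adjMatrix ℝ u v := by
    intro u v
    rw [adjMatrix_pow_symm G (i' + j') v u, adjMatrix_pow_add, adjMatrix_pow_add,
      Finset.sum_mul_sum, Finset.mul_sum]
    refine Finset.sum_congr rfl fun a _ => ?_
    rw [Finset.mul_sum]
    refine Finset.sum_congr rfl fun b _ => ?_
    rw [adjMatrix_pow_symm G i u a, adjMatrix_pow_symm G j' b v]; ring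
  simp_rw [e]
  have comm : ∀ f : V → V → V → V → ℝ,
      ∑ u, ∑ v, ∑ a, ∑ b, f u v a b = ∑ a, ∑ b, ∑ u, ∑ v, f u v a b := by
    intro f
    calc _ = ∑ z : V × V, ∑ y : V × V, f z.1 z.2 y.1 y.2 := by simp only [Fintype.sum_prod_type]
      _ = ∑ y : V × V, ∑ z : V × V, f z.1 z.2 y.1 y.2 := Finset.sum_comm
      _ = _ := by simp only [Fintype.sum_prod_type]
  exact comm _

theorem sum_chord_le {s k : ℕ} (hfree : (completeBipartiteGraph (Fin s) (Fin s)).Free G)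
    (hdeg : 0 < G.minDegree) {p N : ℝ} (hp : 0 < p) (hp1 : p ≤ 1)
    (hN : 4 * (s : ℝ) ^ 2 ≤ N * p ^ (2 * s)) (hN0 : 0 ≤ N) {m m' : ℕ} (hm : 2 ≤ m) (hm' : 2 ≤ m')
    (hmm : m + m' = 2 * (k + 1)) :
    ∑ u, ∑ v, G.adjMatrix ℝ u v * ((G.adjMatrix ℝ ^ m) u v * (G.adjMatrix ℝ ^ m') v u)
      ≤ p * closedWalks G (k + 1) + 2 * N * (G.maxDegree * closedWalks G k) := by
  obtain ⟨i, j, i', j', hi, hj, hi', hj', rfl, rfl, h1, h2⟩ : ∃ i j i' j' : ℕ,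
      1 ≤ i ∧ 1 ≤ j ∧ 1 ≤ i' ∧ 1 ≤ j' ∧ m = i + j ∧ m' = i' + j' ∧
      i + i' = k + 1 ∧ j + j' = k + 1 := by
    -- The points a and b are placed strictly inside the two arcs, which needs m, m' ≥ 2. Both a–b
    -- walks, through u and through v, get length k + 1, so both weights have total (A^{k+1})_ab.
    by_cases h : m ≤ k + 1
    · exact ⟨1, m - 1, k, k + 1 - (m - 1), by omega⟩
    · exact ⟨k, m - k, 1, k + 1 - (m - k), by omega⟩
  rw [sum_chord_eq]
  have h : ∀ a b, ∑ u, ∑ v, ((G.adjMatrix ℝ ^ i) a u * (G.adjMatrix ℝ ^ i') u b) *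
      ((G.adjMatrix ℝ ^ j) a v * (G.adjMatrix ℝ ^ j') v b) * G.adjMatrix ℝ u v
      ≤ p * (G.adjMatrix ℝ ^ (k + 1)) a b ^ 2 +
        N * (∑ u, ((G.adjMatrix ℝ ^ i) a u * (G.adjMatrix ℝ ^ i') u b) ^ 2 +
          ∑ v, ((G.adjMatrix ℝ ^ j) a v * (G.adjMatrix ℝ ^ j') v b) ^ 2) := by
    intro a b
    refine edge_weight_le G hfree hp hp1 hN hN0 _ _
      (fun u => mul_nonneg (adjMatrix_pow_nonneg G _ _ _) (adjMatrix_pow_nonneg G _ _ _))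
      (fun u => mul_nonneg (adjMatrix_pow_nonneg G _ _ _) (adjMatrix_pow_nonneg G _ _ _)) ?_ ?_
    · rw [← h1, adjMatrix_pow_add]
    · rw [← h2, adjMatrix_pow_add]
  refine (Finset.sum_le_sum fun a _ => Finset.sum_le_sum fun b _ => h a b).trans ?_
  simp_rw [Finset.sum_add_distrib, ← Finset.mul_sum, Finset.sum_add_distrib]
  rw [sum_sq_midpoint, sum_sq_midpoint, ← closedWalks_eq_sum_sq]
  have c1 := sum_diag_mul_le G hdeg (m := 2 * i) (m' := 2 * i') (k := k)
    (by omega) (by omega) (by omega)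
  have c2 := sum_diag_mul_le G hdeg (m := 2 * j) (m' := 2 * j') (k := k)
    (by omega) (by omega) (by omega)
  have := mul_le_mul_of_nonneg_left (add_le_add c1 c2) hN0
  linarith

end Chords

/-! ### From homomorphic cycles to walk counts -/

section Cycles

variable {V : Type*} {G : SimpleGraph V}

theorem exists_walk_of_seq {x : ℕ → V} (hx : ∀ k, G.Adj (x k) (x (k + 1))) (m : ℕ) :
    ∀ (a : ℕ) {u v : V}, x a = u → x (a + m) = v →
      ∃ p : G.Walk u v, p.length = m ∧ ∀ k ≤ m, p.getVert k = x (a + k) := by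
  induction m with
  | zero =>
    rintro a u v rfl rfl
    exact ⟨.nil, rfl, fun k hk => by simp [Nat.le_zero.1 hk]⟩
  | succ m ih =>
    rintro a u v rfl hv
    obtain ⟨p, hp, hp'⟩ := ih (a + 1) (v := v) rfl (by rw [← hv]; congr 1; ring)
    refine ⟨.cons (hx a) p, by simp [hp], fun k hk => ?_⟩
    cases k with
    | zero => simp
    | succ k =>
      rw [SimpleGraph.Walk.getVert_cons_succ, hp' k (by omega)]
      congr 1; ring

theorem cycleGraph_adj_of_succ_mod {n : ℕ} (hn : 2 ≤ n) (a : ℕ) :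
    (SimpleGraph.cycleGraph n).Adj ⟨a % n, Nat.mod_lt _ (by omega)⟩
      ⟨(a + 1) % n, Nat.mod_lt _ (by omega)⟩ := by
  obtain ⟨n, rfl⟩ := Nat.exists_eq_add_of_le' hn
  rw [SimpleGraph.cycleGraph_adj]
  right
  rw [sub_eq_iff_eq_add]
  ext
  rw [Fin.val_add]
  simp [add_comm]

theorem succ_mod_of_cycleGraph_adj {n : ℕ} (hn : 2 ≤ n) {i j : Fin n}
    (h : (SimpleGraph.cycleGraph n).Adj i j) :
    (j : ℕ) = (i + 1) % n ∨ (i : ℕ) = (j + 1) % n := by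
  obtain ⟨n, rfl⟩ := Nat.exists_eq_add_of_le' hn
  rw [SimpleGraph.cycleGraph_adj] at h
  rcases h with h | h
  · right
    have e := sub_eq_iff_eq_add'.1 h
    rw [e, Fin.val_add]
    simp
  · left
    have e := sub_eq_iff_eq_add'.1 h
    rw [e, Fin.val_add]
    simp

theorem not_cycleGraph_adj_gap {n : ℕ} (hn : 2 ≤ n) {i j : Fin n} (hij : i < j)
    (h : ¬ (SimpleGraph.cycleGraph n).Adj i j) : (j : ℕ) - i ≠ 1 ∧ (j : ℕ) - i ≠ n - 1 := by
  have hj := j.2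
  have hij' : (i : ℕ) < j := hij
  constructor
  · intro hd
    apply h
    have := cycleGraph_adj_of_succ_mod hn i
    convert this using 1
    · ext; simp [Nat.mod_eq_of_lt i.2]
    · ext
      simp only
      rw [Nat.mod_eq_of_lt (by omega)]
      omega
  · intro hd
    apply h
    have := cycleGraph_adj_of_succ_mod hn j
    rw [SimpleGraph.adj_comm]
    convert this using 1
    · ext; simp [Nat.mod_eq_of_lt j.2]
    · ext
      simp only
      rw [show (j : ℕ) + 1 = n by omega, Nat.mod_self]
      omega

/-- The `n`-periodic vertex sequence traced out by a homomorphic `n`-cycle. -/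
def HomCycle.seq {n : ℕ} (hn : 2 ≤ n) (φ : HomCycle G n) (k : ℕ) : V :=
  φ ⟨k % n, Nat.mod_lt _ (by omega)⟩

theorem HomCycle.seq_val {n : ℕ} (hn : 2 ≤ n) (φ : HomCycle G n) (i : Fin n) :
    φ.seq hn i = φ i := by
  simp [HomCycle.seq, Nat.mod_eq_of_lt i.2]

theorem HomCycle.seq_add {n : ℕ} (hn : 2 ≤ n) (φ : HomCycle G n) (k : ℕ) :
    φ.seq hn (k + n) = φ.seq hn k := by
  simp [HomCycle.seq]

variable [Fintype V] [DecidableEq V] [DecidableRel G.Adj]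

/-- Cutting the cycle at positions i and j gives two walks, which together determine it. -/
theorem card_homCycle_fiber_le {n : ℕ} (hn : 2 ≤ n) [Fintype (HomCycle G n)] {i j : Fin n}
    (hij : i < j) (u v : V) :
    ((Finset.univ.filter fun φ : HomCycle G n => φ i = u ∧ φ j = v).card : ℝ)
      ≤ (G.adjMatrix ℝ ^ ((j : ℕ) - i)) u v * (G.adjMatrix ℝ ^ (n - ((j : ℕ) - i))) v u := by
  have hj := j.2
  have hij' : (i : ℕ) < j := hij
  rw [SimpleGraph.adjMatrix_pow_apply_eq_card_walk, SimpleGraph.adjMatrix_pow_apply_eq_card_walk,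
    ← Nat.cast_mul, ← Fintype.card_prod, ← Fintype.card_subtype]
  have hw : ∀ φ : {φ : HomCycle G n // φ i = u ∧ φ j = v},
      ∃ z : {p : G.Walk u v | p.length = (j : ℕ) - i} ×
          {q : G.Walk v u | q.length = n - ((j : ℕ) - i)},
        (∀ k ≤ (j : ℕ) - i, z.1.1.getVert k = φ.1.seq hn (i + k)) ∧
        ∀ k ≤ n - ((j : ℕ) - i), z.2.1.getVert k = φ.1.seq hn (j + k) := by
    rintro ⟨φ, hu, hv⟩
    have hadj : ∀ k, G.Adj (φ.seq hn k) (φ.seq hn (k + 1)) := fun k =>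
      φ.map_rel (cycleGraph_adj_of_succ_mod hn k)
    obtain ⟨p, hp, hp'⟩ := exists_walk_of_seq hadj ((j : ℕ) - i) i (u := u) (v := v)
      (by rw [φ.seq_val, hu]) (by rw [show (i : ℕ) + (j - i) = j by omega, φ.seq_val, hv])
    obtain ⟨q, hq, hq'⟩ := exists_walk_of_seq hadj (n - ((j : ℕ) - i)) j (u := v) (v := u)
      (by rw [φ.seq_val, hv])
      (by rw [show (j : ℕ) + (n - (j - i)) = i + n by omega, φ.seq_add, φ.seq_val, hu])
    exact ⟨⟨⟨p, hp⟩, ⟨q, hq⟩⟩, hp', hq'⟩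
  choose f hf1 hf2 using hw
  refine Nat.cast_le.2 (Fintype.card_le_of_injective f fun φ ψ h => ?_)
  apply Subtype.ext
  ext r
  have hr := r.2
  rw [← HomCycle.seq_val hn, ← HomCycle.seq_val hn]
  by_cases h1 : (i : ℕ) ≤ r ∧ (r : ℕ) ≤ j
  · rw [show (r : ℕ) = i + (r - i) by omega, ← hf1 φ _ (by omega), ← hf1 ψ _ (by omega), h]
  by_cases h2 : (j : ℕ) ≤ r
  · rw [show (r : ℕ) = j + (r - j) by omega, ← hf2 φ _ (by omega), ← hf2 ψ _ (by omega), h]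
  -- Positions before i lie on the second walk after wrapping around, as r + n.
  · rw [← HomCycle.seq_add, ← HomCycle.seq_add hn ψ.1,
      show (r : ℕ) + n = j + (r + n - j) by omega,
      ← hf2 φ _ (by omega), ← hf2 ψ _ (by omega), h]

theorem card_homCycle_rel_le {n : ℕ} (hn : 2 ≤ n) [Fintype (HomCycle G n)] {i j : Fin n}
    (hij : i < j) (R : V → V → Prop)
    [DecidableRel R] :
    ((Finset.univ.filter fun φ : HomCycle G n => R (φ i) (φ j)).card : ℝ)
      ≤ ∑ u, ∑ v, (if R u v then 1 else 0) *
        ((G.adjMatrix ℝ ^ ((j : ℕ) - i)) u v * (G.adjMatrix ℝ ^ (n - ((j : ℕ) - i))) v u) := by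
  rw [Finset.card_eq_sum_card_fiberwise (f := fun φ : HomCycle G n => (φ i, φ j))
    (t := Finset.univ) (fun _ _ => Finset.mem_coe.2 (Finset.mem_univ _)),
    Fintype.sum_prod_type]
  push_cast
  refine Finset.sum_le_sum fun u _ => Finset.sum_le_sum fun v _ => ?_
  by_cases h : R u v
  · rw [if_pos h, one_mul]
    refine le_trans ?_ (card_homCycle_fiber_le hn hij u v)
    refine Nat.cast_le.2 (Finset.card_le_card fun φ hφ => ?_)
    simpa using (Finset.mem_filter.1 hφ).2
  · rw [if_neg h, zero_mul]
    refine le_of_eq ?_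
    rw [Nat.cast_eq_zero, Finset.card_eq_zero, Finset.filter_filter,
      Finset.filter_eq_empty_iff]
    rintro φ - ⟨hR, he⟩
    obtain ⟨rfl, rfl⟩ := Prod.mk.inj he
    exact h hR

/-- The homomorphic cycle traced out by a closed walk. -/
def homCycleOfWalk {n : ℕ} (hn : 2 ≤ n) {u : V} (p : G.Walk u u) (hp : p.length = n) :
    HomCycle G n where
  toFun i := p.getVert i
  map_rel' := by
    have key : ∀ i j : Fin n, (j : ℕ) = (i + 1) % n → G.Adj (p.getVert i) (p.getVert j) := by
      intro i j h
      have hi := i.2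
      have hadj := p.adj_getVert_succ (i := i) (by omega)
      by_cases hin : (i : ℕ) + 1 = n
      · rw [hin, Nat.mod_self] at h
        rw [p.getVert_of_length_le (i := i + 1) (by omega)] at hadj
        rwa [h, p.getVert_zero]
      · rw [Nat.mod_eq_of_lt (by omega)] at h
        rwa [h]
    intro i j h
    rcases succ_mod_of_cycleGraph_adj hn h with h | h
    · exact key i j h
    · exact (key j i h).symm

theorem closedWalks_le_card_homCycle {k : ℕ} (hk : 1 ≤ k) :
    closedWalks G k ≤ Nat.card (HomCycle G (2 * k)) := by
  have hn : 2 ≤ 2 * k := by omega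
  unfold closedWalks
  simp_rw [SimpleGraph.adjMatrix_pow_apply_eq_card_walk]
  rw [← Nat.cast_sum, ← Fintype.card_sigma, ← Nat.card_eq_fintype_card]
  refine Nat.cast_le.2 (Nat.card_le_card_of_injective
    (fun z => homCycleOfWalk hn z.2.1 z.2.2) ?_)
  rintro ⟨u, p, hp⟩ ⟨v, q, hq⟩ h
  have hp' : p.length = 2 * k := hp
  have hq' : q.length = 2 * k := hq
  have hget : ∀ r < 2 * k, p.getVert r = q.getVert r := fun r hr => DFunLike.congr_fun h ⟨r, hr⟩
  obtain rfl : u = v := by simpa using hget 0 (by omega)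
  have : p = q := by
    refine SimpleGraph.Walk.ext_getVert_le_length (hp'.trans hq'.symm) fun r hr => ?_
    rcases (show r ≤ 2 * k by omega).lt_or_eq with h1 | h1
    · exact hget r h1
    · rw [p.getVert_of_length_le (by omega), q.getVert_of_length_le (by omega)]
  subst this
  rfl

-- Union bound over pairs of positions. In the coefficient 1 + 2N, the 1 pays for a coincidence and
-- 2N for the error term of a chord.
open Classical in
theorem card_not_isInduced_le {s k : ℕ} (hk : 1 ≤ k) [Fintype (HomCycle G (2 * (k + 1)))]
    (hfree : (completeBipartiteGraph (Fin s) (Fin s)).Free G)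
    (hdeg : 0 < G.minDegree) {p N : ℝ} (hp : 0 < p) (hp1 : p ≤ 1)
    (hN : 4 * (s : ℝ) ^ 2 ≤ N * p ^ (2 * s)) (hN0 : 0 ≤ N) :
    ((Finset.univ.filter fun φ : HomCycle G (2 * (k + 1)) => ¬ φ.IsInduced).card : ℝ)
      ≤ (2 * (k + 1)) ^ 2 * (p * closedWalks G (k + 1)
        + (1 + 2 * N) * (G.maxDegree * closedWalks G k)) := by
  have hn : 2 ≤ 2 * (k + 1) := by omega
  set E : ℝ := G.maxDegree * closedWalks G k
  have hH : ∀ k, 0 ≤ closedWalks G k := fun k =>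
    Finset.sum_nonneg fun v _ => adjMatrix_pow_nonneg G _ _ _
  have hE : 0 ≤ E := mul_nonneg (by positivity) (hH k)
  have hchord : 0 ≤ p * closedWalks G (k + 1) + 2 * N * E := by
    have := hH (k + 1)
    positivity
  let B : Fin (2 * (k + 1)) × Fin (2 * (k + 1)) → Finset (HomCycle G (2 * (k + 1))) := fun z =>
    Finset.univ.filter fun φ => z.1 < z.2 ∧ (φ z.1 = φ z.2 ∨
      (G.Adj (φ z.1) (φ z.2) ∧ ¬ (SimpleGraph.cycleGraph (2 * (k + 1))).Adj z.1 z.2))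
  have hsub : (Finset.univ.filter fun φ : HomCycle G (2 * (k + 1)) => ¬ φ.IsInduced)
      ⊆ Finset.univ.biUnion B := by
    intro φ hφ
    have hφ : ¬ φ.IsInduced := (Finset.mem_filter.1 hφ).2
    simp only [Finset.mem_biUnion, Finset.mem_univ, true_and, B, Finset.mem_filter]
    rw [HomCycle.IsInduced, not_and_or] at hφ
    rcases hφ with h | h
    · rw [Function.not_injective_iff] at h
      obtain ⟨i, j, he, hne⟩ := h
      rcases lt_or_gt_of_ne hne with hlt | hlt
      · exact ⟨(i, j), hlt, Or.inl he⟩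
      · exact ⟨(j, i), hlt, Or.inl he.symm⟩
    · push Not at h
      obtain ⟨i, j, hadj, hnc⟩ := h
      have hne : i ≠ j := by
        rintro rfl
        exact hadj.ne rfl
      rcases lt_or_gt_of_ne hne with hlt | hlt
      · exact ⟨(i, j), hlt, Or.inr ⟨hadj, hnc⟩⟩
      · exact ⟨(j, i), hlt, Or.inr ⟨hadj.symm, fun h => hnc h.symm⟩⟩
  have hB : ∀ z, ((B z).card : ℝ) ≤ p * closedWalks G (k + 1) + (1 + 2 * N) * E := by
    rintro ⟨i, j⟩
    by_cases hij : i < j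
    swap
    · have : B (i, j) = ∅ := by simp [B, hij]
      rw [this]
      simp only [Finset.card_empty, Nat.cast_zero]
      linarith
    have hij' : (i : ℕ) < j := hij
    have hj := j.2
    have heq : ((Finset.univ.filter fun φ : HomCycle G (2 * (k + 1)) => φ i = φ j).card : ℝ)
        ≤ E := by
      refine (card_homCycle_rel_le (G := G) hn hij fun u v => u = v).trans ?_
      simp only [ite_mul, one_mul, zero_mul, Finset.sum_ite_eq, Finset.mem_univ, if_true]
      exact sum_diag_mul_le G hdeg (by omega) (by omega) (by omega)
    by_cases hc : (SimpleGraph.cycleGraph (2 * (k + 1))).Adj i j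
    · have hle : (B (i, j)).card
          ≤ (Finset.univ.filter fun φ : HomCycle G (2 * (k + 1)) => φ i = φ j).card := by
        refine Finset.card_le_card fun φ hφ => ?_
        have := (Finset.mem_filter.1 hφ).2.2
        simpa [hc] using this
      have hle' : ((B (i, j)).card : ℝ) ≤ _ := Nat.cast_le.2 hle
      linarith
    · obtain ⟨g1, g2⟩ := not_cycleGraph_adj_gap hn hij hc
      have hadj : ((Finset.univ.filter fun φ : HomCycle G (2 * (k + 1)) =>
          G.Adj (φ i) (φ j)).card : ℝ) ≤ p * closedWalks G (k + 1) + 2 * N * E := by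
        refine (card_homCycle_rel_le (G := G) hn hij G.Adj).trans ?_
        have := sum_chord_le G (k := k) hfree hdeg hp hp1 hN hN0 (m := (j : ℕ) - i)
          (m' := 2 * (k + 1) - ((j : ℕ) - i)) (by omega) (by omega) (by omega)
        simpa only [SimpleGraph.adjMatrix_apply] using this
      have hle : (B (i, j)).card
          ≤ (Finset.univ.filter fun φ : HomCycle G (2 * (k + 1)) => φ i = φ j).card
            + (Finset.univ.filter fun φ : HomCycle G (2 * (k + 1)) =>
                G.Adj (φ i) (φ j)).card := by
        refine le_trans (Finset.card_le_card fun φ hφ => ?_) (Finset.card_union_le _ _)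
        have := (Finset.mem_filter.1 hφ).2.2
        simpa [hc] using this
      have hle' : ((B (i, j)).card : ℝ) ≤ _ := Nat.cast_le.2 hle
      push_cast at hle'
      linarith
  calc _ ≤ ((Finset.univ.biUnion B).card : ℝ) := Nat.cast_le.2 (Finset.card_le_card hsub)
    _ ≤ ∑ z, ((B z).card : ℝ) := by exact_mod_cast Finset.card_biUnion_le
    _ ≤ ∑ _z : Fin (2 * (k + 1)) × Fin (2 * (k + 1)),
        (p * closedWalks G (k + 1) + (1 + 2 * N) * E) := Finset.sum_le_sum fun z _ => hB z
    _ = _ := by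
      rw [Finset.sum_const, Finset.card_univ, Fintype.card_prod, Fintype.card_fin, nsmul_eq_mul]
      push_cast
      ring

end Cycles

/-! ### Constants and conclusion -/

/-- The maximum degree is at least the average degree, which exceeds D n^{1/l}. -/
theorem le_maxDegree_pow {V : Type*} [Fintype V] [DecidableEq V] [Nonempty V]
    (G : SimpleGraph V) [DecidableRel G.Adj] {D : ℝ} {l : ℕ} (hl : l ≠ 0) (hD : 0 ≤ D)
    (he : D * (Fintype.card V : ℝ) ^ (1 + 1 / (l : ℝ)) < 2 * G.edgeFinset.card) :
    D ^ l * Fintype.card V ≤ (G.maxDegree : ℝ) ^ l := by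
  have hn : 0 < (Fintype.card V : ℝ) := by exact_mod_cast Fintype.card_pos
  have h1 : 2 * (G.edgeFinset.card : ℝ) ≤ Fintype.card V * G.maxDegree := by
    have : ∑ v, G.degree v ≤ Fintype.card V * G.maxDegree := by
      simpa using Finset.sum_le_card_nsmul Finset.univ (fun v => G.degree v) G.maxDegree
        (fun v _ => G.degree_le_maxDegree v)
    rw [G.sum_degrees_eq_twice_card_edges] at this
    exact_mod_cast this
  rw [Real.rpow_add hn, Real.rpow_one] at he
  have h2 : D * (Fintype.card V : ℝ) ^ (1 / (l : ℝ)) ≤ G.maxDegree := by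
    refine le_of_mul_le_mul_left ?_ hn
    linarith
  have h3 := pow_le_pow_left₀ (by positivity) h2 l
  rwa [mul_pow, one_div, Real.rpow_inv_natCast_pow hn.le hl] at h3

theorem one_add_two_mul_le {x : ℝ} (hx : 4 ≤ x) (s : ℕ) :
    1 + 2 * (4 * (s : ℝ) ^ 2 * (16 * x ^ 2) ^ (2 * s)) ≤ 9 * x ^ (9 * s) := by
  have h1 : (s : ℝ) ^ 2 ≤ x ^ s := by
    have : (s : ℝ) ≤ 2 ^ s := by exact_mod_cast Nat.lt_two_pow_self.le
    calc (s : ℝ) ^ 2 ≤ (2 ^ s) ^ 2 := by gcongr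
      _ = 4 ^ s := by rw [← pow_mul, mul_comm, pow_mul]; norm_num
      _ ≤ x ^ s := by gcongr
  have h2 : (16 * x ^ 2) ^ (2 * s) ≤ x ^ (8 * s) := by
    rw [pow_mul, pow_mul]
    refine pow_le_pow_left₀ (by positivity) ?_ s
    calc (16 * x ^ 2) ^ 2 = 4 ^ 4 * x ^ 4 := by ring
      _ ≤ x ^ 4 * x ^ 4 := by gcongr
      _ = x ^ 8 := by ring
  have h3 : 1 ≤ x ^ (9 * s) := one_le_pow₀ (by linarith)
  have h4 : (s : ℝ) ^ 2 * (16 * x ^ 2) ^ (2 * s) ≤ x ^ (9 * s) := by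
    calc _ ≤ x ^ s * x ^ (8 * s) := by gcongr
      _ = _ := by rw [← pow_add]; congr 1; ring
  linarith

/-- The chord term p = 1/(16x²) costs 1/(4t²). The rest costs 1/(8t²), since 9/(2·144) = 1/32 and
x^{9s} ≤ x^{20s}. The total is 3/8 of 1/t², below the allowed 1/2. -/
theorem bad_fraction_le {l t x K H E N : ℝ} (s : ℕ) (hl : 0 < l) (ht : 0 < t) (hx : x = l * t)
    (hx4 : 4 ≤ x) (hK : 0 < K) (hH : 0 ≤ H) (hE0 : 0 ≤ E) (hN : 1 + 2 * N ≤ 9 * x ^ (9 * s))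
    (hE : E ≤ K ^ 2 / (2 * (144 * x ^ 2 * K ^ 2 * x ^ (20 * s))) * H) :
    (2 * l) ^ 2 * (1 / (16 * x ^ 2) * H + (1 + 2 * N) * E) ≤ 1 / (2 * t ^ 2) * H := by
  have hx0 : 0 < x := by linarith
  have hNE : (1 + 2 * N) * E ≤ 1 / (32 * x ^ 2) * H := by
    calc (1 + 2 * N) * E ≤ 9 * x ^ (9 * s) *
          (K ^ 2 / (2 * (144 * x ^ 2 * K ^ 2 * x ^ (20 * s))) * H) :=
          mul_le_mul hN hE hE0 (by positivity)
      _ = 1 / (32 * x ^ 2) * (x ^ (9 * s) / x ^ (20 * s)) * H := by field_simp; ring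
      _ ≤ 1 / (32 * x ^ 2) * 1 * H := by
        gcongr
        exact div_le_one_of_le₀ (pow_le_pow_right₀ (by linarith) (by omega)) (by positivity)
      _ = _ := by ring
  calc _ ≤ (2 * l) ^ 2 * (1 / (16 * x ^ 2) * H + 1 / (32 * x ^ 2) * H) := by gcongr
    _ = 3 / 8 * (1 / t ^ 2 * H) := by rw [hx]; field_simp; ring
    _ ≤ 1 / 2 * (1 / t ^ 2 * H) :=
        mul_le_mul_of_nonneg_right (by norm_num) (by positivity)
    _ = _ := by field_simp

theorem mainTheorem7 (l t : ℕ) (hl : 2 ≤ l) (ht : 2 ≤ t) :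
    ∃ C : ℝ, 0 < C ∧
      ∀ (s n : ℕ) (V : Type*) [Fintype V] [DecidableEq V]
        (G : SimpleGraph V) [DecidableRel G.Adj],
        Fintype.card V = n →
        IsAlmostRegular G ((2 : ℝ) ^ (4 * l + 2)) →
        (completeBipartiteGraph (Fin s) (Fin s)).Free G →
        (G.edgeFinset.card : ℝ) >
          C * ((l : ℝ) * (t : ℝ)) ^ (20 * s) * (n : ℝ) ^ (1 + 1 / (l : ℝ)) →
        1 - 1 / (2 * (t : ℝ) ^ 2) ≤
          (Nat.card {φ : HomCycle G (2 * l) // φ.IsInduced} : ℝ) /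
            (Nat.card (HomCycle G (2 * l)) : ℝ) := by
  classical
  obtain ⟨k, rfl⟩ : ∃ k, l = k + 1 := ⟨l - 1, by omega⟩
  set x : ℝ := ((k + 1 : ℕ) : ℝ) * (t : ℝ) with hx
  set K : ℝ := (2 : ℝ) ^ (4 * (k + 1) + 2)
  have hl' : (2 : ℝ) ≤ ((k + 1 : ℕ) : ℝ) := by exact_mod_cast hl
  have ht' : (2 : ℝ) ≤ t := by exact_mod_cast ht
  have hx4 : 4 ≤ x := by nlinarith
  have hx0 : 0 < x := by linarith
  have hK : 0 < K := by positivity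
  refine ⟨144 * x ^ 2 * K ^ 2, by positivity, ?_⟩
  intro s n V _ _ G _ hn hreg hfree he
  subst hn
  have hne : Nonempty V := by
    by_contra h
    rw [not_nonempty_iff] at h
    have h1 : (0 : ℝ) ≤ 144 * x ^ 2 * K ^ 2 * x ^ (20 * s) *
        (Fintype.card V : ℝ) ^ (1 + 1 / ((k + 1 : ℕ) : ℝ)) := by positivity
    have h2 : G.edgeFinset.card = 0 := by
      rw [Finset.card_eq_zero, Finset.eq_empty_iff_forall_notMem]
      intro e
      induction e with | h a b => exact h.elim a
    rw [h2] at he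
    simp only [Nat.cast_zero] at he
    linarith
  -- The factor 2 turns the edge count into the degree sum.
  set D : ℝ := 2 * (144 * x ^ 2 * K ^ 2 * x ^ (20 * s)) with hD
  have hD0 : 0 < D := by positivity
  have hmax := le_maxDegree_pow G (D := D) (Nat.succ_ne_zero k) hD0.le (by
    rw [hD]; simp only [Nat.succ_eq_add_one]; linarith)
  -- If δ = 0, almost-regularity gives Δ = 0, against `hmax`.
  have hmin : 0 < G.minDegree := by
    rw [Nat.pos_iff_ne_zero]
    intro h0
    have h1 : (G.maxDegree : ℝ) ≤ 0 := by simpa [IsAlmostRegular, h0] using hreg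
    have h2 : (G.maxDegree : ℝ) = 0 := le_antisymm h1 (by positivity)
    rw [h2, zero_pow (Nat.succ_ne_zero k)] at hmax
    have : 0 < D ^ (k + 1) * (Fintype.card V : ℝ) := by
      have : 0 < (Fintype.card V : ℝ) := by exact_mod_cast Fintype.card_pos
      positivity
    exact absurd hmax (not_le.2 this)
  have hE := maxDegree_mul_closedWalks_le G hK hD0 hmin hreg hmax
  have hHpos := closedWalks_pos G hmin
  have : Finite (HomCycle G (2 * (k + 1))) := DFunLike.finite _
  have := Fintype.ofFinite (HomCycle G (2 * (k + 1)))
  -- N is chosen so that N p^{2s} = 4s² exactly.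
  have hbad := card_not_isInduced_le (G := G) (s := s) (k := k) (by omega) hfree hmin
    (p := 1 / (16 * x ^ 2)) (N := 4 * (s : ℝ) ^ 2 * (16 * x ^ 2) ^ (2 * s)) (by positivity)
    (by rw [div_le_one (by positivity)]; nlinarith)
    (by rw [mul_assoc, ← mul_pow, mul_one_div_cancel (by positivity), one_pow, mul_one])
    (by positivity)
  have hfrac := bad_fraction_le s (l := ((k + 1 : ℕ) : ℝ)) (t := t) (by linarith) (by linarith) hx
    hx4 hK (hHpos (k + 1)).le (mul_nonneg (Nat.cast_nonneg G.maxDegree) (hHpos k).le)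
    (one_add_two_mul_le hx4 s) hE
  push_cast at hfrac
  have hcard := closedWalks_le_card_homCycle (G := G) (k := k + 1) (by omega)
  have htot := Finset.card_filter_add_card_filter_not
    (s := (Finset.univ : Finset (HomCycle G (2 * (k + 1))))) (fun φ => φ.IsInduced)
  rw [Nat.card_eq_fintype_card] at hcard
  rw [Nat.card_eq_fintype_card, Nat.card_eq_fintype_card, Fintype.card_subtype]
  rw [Finset.card_univ] at htot
  have htot' : ((Finset.univ.filter fun φ : HomCycle G (2 * (k + 1)) => φ.IsInduced).card : ℝ)
      + ((Finset.univ.filter fun φ : HomCycle G (2 * (k + 1)) => ¬ φ.IsInduced).card : ℝ)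
      = Fintype.card (HomCycle G (2 * (k + 1))) := by exact_mod_cast htot
  rw [le_div_iff₀ ((hHpos _).trans_le hcard)]
  have h5 : 1 / (2 * (t : ℝ) ^ 2) * closedWalks G (k + 1)
      ≤ 1 / (2 * (t : ℝ) ^ 2) * Fintype.card (HomCycle G (2 * (k + 1))) := by gcongr
  linarith
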